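/- Let $K$ be a field. For $n\ge 1$ let $R=K[x_1,\dots,x_n]$, and let $K_n$ be the complete graph on the vertex set $\{1,\dots,n\}$. For an ideal $L\subseteq R$ write $\mathrm{Ass}(L)=\mathrm{Ass}_R(R/L)$ for the set of associated primes of the $R$-module $R/L$. The edge ideal $I(K_n)\subseteq R$ is the ideal generated by the monomials $x_ix_j$ with $\{i,j\}$ an edge of $K_n$, and the cover ideal $J(K_n)\subseteq R$ is the ideal generated by all monomials $M$ such that for every edge $\{i,j\}$ of $K_n$ we have $x_i\mid M$ or $x_j\mid M$. Then the following statements hold: (i) $(x_1,\dots,x_n)\in\mathrm{Ass}(J(K_n)^t)$ for all $n\ge 2$ and all $t\ge n-1$. (ii) $(x_1,\dots,x_n)\in\mathrm{Ass}(I(K_n)^t)$ for all $n\ge 3$ and all $t\ge 2$. -/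

import Mathlib

/-- The edge ideal `I(G)` of a simple graph `G` in the polynomial ring `K[x_v : v ∈ V]`: the ideal
generated by the monomials `x_i x_j` for every edge `{i, j}` of `G`. -/
noncomputable def edgeIdeal (K : Type*) [Field K] {V : Type*} (G : SimpleGraph V) :
    Ideal (MvPolynomial V K) :=
  Ideal.span {f | ∃ i j : V, G.Adj i j ∧ f = MvPolynomial.X i * MvPolynomial.X j}

/-- The cover ideal `J(G)` of a simple graph `G` in the polynomial ring `K[x_v : v ∈ V]`: the ideal
generated by all monomials `M` such that, for every edge `{i, j}` of `G`, `x_i ∣ M` or `x_j ∣ M`.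
Here `M` is given by its exponent vector `d`, so that `x_i ∣ M` means `d i ≠ 0`. -/
noncomputable def coverIdeal (K : Type*) [Field K] {V : Type*} (G : SimpleGraph V) :
    Ideal (MvPolynomial V K) :=
  Ideal.span {f | ∃ d : V →₀ ℕ, (∀ i j : V, G.Adj i j → d i ≠ 0 ∨ d j ≠ 0) ∧
    f = MvPolynomial.monomial d 1}

/-! Both parts exhibit a socle element: a monomial `w` outside the power `L ^ t` with every `X i *
w` inside it. Non-membership is by degree: all generators of `L` have degree at least `d`, so `L ^
t` lies in the `d * t`-th power of the maximal ideal, while `w` has degree `d * t - 1`. Membership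
is an explicit factorization into generators. -/

open MvPolynomial in
theorem isMaximal_idealOfVars (σ K : Type*) [Field K] : (idealOfVars σ K).IsMaximal := by
  have h : idealOfVars σ K = RingHom.ker (constantCoeff : MvPolynomial σ K →+* K) := by
    ext p
    have := mem_pow_idealOfVars_iff' (σ := σ) (R := K) 1 p
    rw [pow_one] at this
    rw [this, RingHom.mem_ker, constantCoeff_eq]
    refine ⟨fun h => h 0 (by simp), fun h x hx => ?_⟩
    have hx0 : x = 0 := (Finsupp.degree_eq_zero_iff x).mp (Nat.lt_one_iff.mp hx)
    rw [hx0, h]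
  rw [h]
  exact RingHom.ker_isMaximal_of_surjective _ fun a => ⟨C a, constantCoeff_C _ a⟩

open MvPolynomial in
theorem notMem_pow_idealOfVars_of_isHomogeneous {σ K : Type*} [Field K] {w : MvPolynomial σ K}
    {k d : ℕ} (hw : w.IsHomogeneous k) (hw0 : w ≠ 0) (hkd : k < d) :
    w ∉ idealOfVars σ K ^ d := by
  intro hmem
  obtain ⟨e, he⟩ := ne_zero_iff.mp hw0
  refine he ((mem_pow_idealOfVars_iff' d w).mp hmem e ?_)
  rw [Finsupp.degree_eq_weight_one]
  exact (hw he).trans_lt hkd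

open MvPolynomial in
/-- A socle element of `R ⧸ L` makes the ideal of the variables an associated prime. -/
theorem idealOfVars_mem_associatedPrimes {σ K : Type*} [Finite σ] [Field K]
    {L : Ideal (MvPolynomial σ K)} (w : MvPolynomial σ K) (hw : w ∉ L)
    (hX : ∀ i, X i * w ∈ L) :
    idealOfVars σ K ∈ associatedPrimes (MvPolynomial σ K) (MvPolynomial σ K ⧸ L) := by
  have hmax := isMaximal_idealOfVars σ K
  refine (Submodule.isAssociatedPrime_iff).mpr ⟨hmax.isPrime, Ideal.Quotient.mk L w, ?_⟩
  have key (r : MvPolynomial σ K) : r ∈ Submodule.colon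
      (⊥ : Submodule (MvPolynomial σ K) (MvPolynomial σ K ⧸ L)) {Ideal.Quotient.mk L w} ↔
      r * w ∈ L := by
    rw [Submodule.mem_colon_singleton, Submodule.mem_bot, ← Ideal.Quotient.eq_zero_iff_mem]
    rfl
  -- By maximality, a proper annihilator containing all variables is the ideal they generate.
  refine hmax.eq_of_le ?_ ?_
  · rw [Ne, Ideal.eq_top_iff_one, key, one_mul]
    exact hw
  · rw [Ideal.span_le]
    rintro _ ⟨i, rfl⟩
    exact (key _).mpr (hX i)

open MvPolynomial in
theorem edgeIdeal_le_sq_idealOfVars (K : Type*) [Field K] {V : Type*} (G : SimpleGraph V) :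
    edgeIdeal K G ≤ idealOfVars V K ^ 2 := by
  refine Ideal.span_le.mpr ?_
  rintro _ ⟨i, j, -, rfl⟩
  rw [pow_two]
  exact Ideal.mul_mem_mul (Ideal.subset_span ⟨i, rfl⟩) (Ideal.subset_span ⟨j, rfl⟩)

-- Two vertices missed by a cover would span an uncovered edge, so at most one exponent vanishes.
open MvPolynomial in
theorem coverIdeal_completeGraph_le_pow_idealOfVars (K : Type*) [Field K] {V : Type*} [Fintype V] :
    coverIdeal K (SimpleGraph.completeGraph V) ≤ idealOfVars V K ^ (Fintype.card V - 1) := by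
  classical
  refine Ideal.span_le.mpr ?_
  rintro _ ⟨d, hd, rfl⟩
  refine (mem_pow_idealOfVars_iff' _ _).mpr fun e he => ?_
  rw [coeff_monomial, if_neg]
  rintro rfl
  refine he.not_ge ?_
  have hzero : (Finset.univ.filter fun i => d i = 0).card ≤ 1 := by
    refine Finset.card_le_one.mpr fun i hi j hj => ?_
    by_contra hij
    simp only [Finset.mem_filter_univ] at hi hj
    rcases hd i j hij with h | h <;> contradiction
  have hsplit := Finset.card_filter_add_card_filter_not (s := (Finset.univ : Finset V))
    (fun i => d i = 0)
  have hdeg : (Finset.univ.filter fun i => ¬ d i = 0).card ≤ d.degree := by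
    rw [Finsupp.degree_eq_sum, Finset.card_eq_sum_ones, Finset.sum_filter]
    refine Finset.sum_le_sum fun i _ => ?_
    split_ifs <;> omega
  rw [Finset.card_univ] at hsplit
  omega

open MvPolynomial in
theorem prod_erase_X_mem_coverIdeal (K : Type*) [Field K] {V : Type*} [Fintype V] [DecidableEq V]
    (i : V) :
    ∏ k ∈ Finset.univ.erase i, X k ∈ coverIdeal K (SimpleGraph.completeGraph V) := by
  refine Ideal.subset_span ⟨∑ k ∈ Finset.univ.erase i, Finsupp.single k 1, ?_, ?_⟩
  · have hne (a : V) (ha : a ≠ i) :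
        (∑ k ∈ Finset.univ.erase i, Finsupp.single k 1 : V →₀ ℕ) a ≠ 0 := by
      rw [Finsupp.finsetSum_apply, Finset.sum_eq_single_of_mem a (by simpa using ha)
        fun b _ hb => Finsupp.single_eq_of_ne' hb]
      simp
    intro a b hab
    by_cases ha : a = i
    · exact Or.inr (hne b fun hb => hab (ha.trans hb.symm))
    · exact Or.inl (hne a ha)
  · rw [monomial_sum_one]
    rfl

/-- A division-free way to compute products of the minimal covers. -/
theorem Finset.prod_prod_erase_mul_prod {ι M : Type*} [CommMonoid M] [DecidableEq ι]
    {s t : Finset ι} (hst : s ⊆ t) (f : ι → M) :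
    (∏ i ∈ s, ∏ k ∈ t.erase i, f k) * ∏ i ∈ s, f i = (∏ k ∈ t, f k) ^ s.card := by
  rw [← Finset.prod_mul_distrib, ← Finset.prod_const]
  exact Finset.prod_congr rfl fun i hi => Finset.prod_erase_mul _ _ (hst hi)

open MvPolynomial in
theorem idealOfVars_mem_associatedPrimes_coverIdeal_pow (K : Type*) [Field K] {V : Type*}
    [Fintype V] (hV : 2 ≤ Fintype.card V) {t : ℕ} (ht : Fintype.card V - 1 ≤ t) :
    idealOfVars V K ∈ associatedPrimes (MvPolynomial V K)
      (MvPolynomial V K ⧸ coverIdeal K (SimpleGraph.completeGraph V) ^ t) := by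
  classical
  obtain ⟨m, hm⟩ : ∃ m, Fintype.card V = m + 2 := ⟨_, (Nat.sub_add_cancel hV).symm⟩
  obtain ⟨s, rfl⟩ : ∃ s, t = s + m + 1 := ⟨t - (m + 1), by omega⟩
  obtain ⟨v⟩ : Nonempty V := Fintype.card_pos_iff.mp (by omega)
  set S : Finset V := Finset.univ.erase v with hS
  have hScard : S.card = m + 1 := by
    rw [hS, Finset.card_erase_of_mem (Finset.mem_univ v), Finset.card_univ]; omega
  set Q : MvPolynomial V K := ∏ k ∈ S, X k with hQ
  have hprod (T : Finset V) : ∏ k ∈ T, (X k : MvPolynomial V K) ≠ 0 :=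
    Finset.prod_ne_zero_iff.mpr fun k _ => X_ne_zero k
  have hall : ∏ k, (X k : MvPolynomial V K) = Q * X v :=
    (Finset.prod_erase_mul _ _ (Finset.mem_univ v)).symm
  set J := coverIdeal K (SimpleGraph.completeGraph V) with hJ
  have hmem (a : ℕ) (T : Finset V) :
      Q ^ a * ∏ i ∈ T, ∏ k ∈ Finset.univ.erase i, X k ∈ J ^ (a + T.card) := by
    rw [pow_add, ← Finset.prod_const]
    exact Ideal.mul_mem_mul (Ideal.pow_mem_pow (prod_erase_X_mem_coverIdeal K v) a)
      (Ideal.prod_mem_prod fun i _ => prod_erase_X_mem_coverIdeal K i)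
  -- The degree is `m + (m + 1) * (s + m)`, one less than `(m + 1) * t`.
  refine idealOfVars_mem_associatedPrimes (X v ^ m * Q ^ (s + m)) ?_ fun j => ?_
  · have hQh : Q.IsHomogeneous (m + 1) := by
      have := IsHomogeneous.prod S (fun k => (X k : MvPolynomial V K)) (fun _ => 1)
        fun k _ => isHomogeneous_X K k
      simpa [hScard] using this
    intro h
    have h2 : J ^ (s + m + 1) ≤ idealOfVars V K ^ ((m + 1) * (s + m + 1)) := by
      rw [pow_mul]
      refine Ideal.pow_right_mono ?_ _
      have := coverIdeal_completeGraph_le_pow_idealOfVars K (V := V)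
      rwa [hm] at this
    refine notMem_pow_idealOfVars_of_isHomogeneous
      (((isHomogeneous_X K v).pow m).mul (hQh.pow (s + m)))
      (mul_ne_zero (pow_ne_zero _ (X_ne_zero v)) (pow_ne_zero _ (hprod S))) ?_ (h2 h)
    nlinarith
  · by_cases hj : j = v
    · subst hj
      have h := hmem s S
      rw [hScard, ← add_assoc] at h
      convert h using 1
      refine mul_right_cancel₀ (hprod S) ?_
      rw [mul_assoc (Q ^ s), Finset.prod_prod_erase_mul_prod (Finset.subset_univ S), hall, hScard,
        ← hQ]
      ring
    -- Compared with `j = v`, the cover omitting `j` is traded for one more copy of `Q`.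
    · have hjS : j ∈ S := Finset.mem_erase.mpr ⟨hj, Finset.mem_univ j⟩
      have h := hmem (s + 1) (S.erase j)
      have hc : (S.erase j).card = m := by rw [Finset.card_erase_of_mem hjS, hScard]; rfl
      rw [hc, add_right_comm] at h
      convert h using 1
      refine mul_right_cancel₀ (hprod (S.erase j)) ?_
      rw [mul_assoc (Q ^ (s + 1)), Finset.prod_prod_erase_mul_prod (Finset.subset_univ _), hall, hc]
      have hQj : X j * ∏ k ∈ S.erase j, X k = Q := Finset.mul_prod_erase S _ hjS
      calc X j * (X v ^ m * Q ^ (s + m)) * ∏ k ∈ S.erase j, X k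
          = X v ^ m * Q ^ (s + m) * (X j * ∏ k ∈ S.erase j, X k) := by ring
        _ = Q ^ (s + 1) * (Q * X v) ^ m := by rw [hQj]; ring

open MvPolynomial in
theorem idealOfVars_mem_associatedPrimes_edgeIdeal_pow (K : Type*) [Field K] {V : Type*}
    [Finite V] {a b c : V} (hab : a ≠ b) (hac : a ≠ c) (hbc : b ≠ c) {t : ℕ} (ht : 2 ≤ t) :
    idealOfVars V K ∈ associatedPrimes (MvPolynomial V K)
      (MvPolynomial V K ⧸ edgeIdeal K (SimpleGraph.completeGraph V) ^ t) := by
  obtain ⟨s, rfl⟩ : ∃ s, t = s + 2 := ⟨_, (Nat.sub_add_cancel ht).symm⟩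
  set I := edgeIdeal K (SimpleGraph.completeGraph V) with hI
  have hedge {i j : V} (hij : i ≠ j) : (X i * X j : MvPolynomial V K) ∈ I :=
    Ideal.subset_span ⟨i, j, hij, rfl⟩
  have hmem {i j k l : V} (hij : i ≠ j) (hkl : k ≠ l) :
      (X a * X b : MvPolynomial V K) ^ s * (X i * X j * (X k * X l)) ∈ I ^ (s + 2) := by
    rw [pow_add, pow_two]
    exact Ideal.mul_mem_mul (Ideal.pow_mem_pow (hedge hab) s)
      (Ideal.mul_mem_mul (hedge hij) (hedge hkl))
  refine idealOfVars_mem_associatedPrimes ((X a * X b) ^ s * (X a * X b * X c)) ?_ fun j => ?_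
  · intro h
    have h2 : I ^ (s + 2) ≤ idealOfVars V K ^ (2 * (s + 2)) := by
      rw [pow_mul]
      exact Ideal.pow_right_mono (edgeIdeal_le_sq_idealOfVars K _) _
    have hX := isHomogeneous_X (R := K) (σ := V)
    refine notMem_pow_idealOfVars_of_isHomogeneous
      ((((hX a).mul (hX b)).pow s).mul (((hX a).mul (hX b)).mul (hX c))) ?_ ?_ (h2 h)
    · have hne := X_ne_zero (R := K) (σ := V)
      exact mul_ne_zero (pow_ne_zero _ (mul_ne_zero (hne a) (hne b)))
        (mul_ne_zero (mul_ne_zero (hne a) (hne b)) (hne c))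
    · omega
  · by_cases hj : j = a
    · subst hj
      convert hmem hab hac using 1
      ring
    -- Regroup as `(b c)(a j)`, which also works for `j = b` or `j = c`.
    · convert hmem hbc (Ne.symm hj) using 1
      ring

theorem corollary3p6 (K : Type*) [Field K] :
    (∀ n : ℕ, 2 ≤ n → ∀ t : ℕ, n - 1 ≤ t →
      Ideal.span (Set.range (MvPolynomial.X : Fin n → MvPolynomial (Fin n) K)) ∈
        associatedPrimes (MvPolynomial (Fin n) K)
          (MvPolynomial (Fin n) K ⧸ (coverIdeal K (SimpleGraph.completeGraph (Fin n))) ^ t)) ∧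
    (∀ n : ℕ, 3 ≤ n → ∀ t : ℕ, 2 ≤ t →
      Ideal.span (Set.range (MvPolynomial.X : Fin n → MvPolynomial (Fin n) K)) ∈
        associatedPrimes (MvPolynomial (Fin n) K)
          (MvPolynomial (Fin n) K ⧸ (edgeIdeal K (SimpleGraph.completeGraph (Fin n))) ^ t)) := by
  refine ⟨fun n hn t ht => ?_, fun n hn t ht => ?_⟩
  · exact idealOfVars_mem_associatedPrimes_coverIdeal_pow K (by simpa using hn) (by simpa using ht)
  · exact idealOfVars_mem_associatedPrimes_edgeIdeal_pow K
      (a := (⟨0, by omega⟩ : Fin n)) (b := ⟨1, by omega⟩) (c := ⟨2, by omega⟩)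
      (Fin.ne_of_val_ne (by norm_num)) (Fin.ne_of_val_ne (by norm_num))
      (Fin.ne_of_val_ne (by norm_num)) ht
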